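/- Let $n\ge 0$ and $k\ge 1$ be integers. Let $a\in[0,1]^n$ be a vector of item sizes and $v\in\mathbb{R}_{>0}^n$ a vector of item values such that $a_i\in\left(\frac1{k+1},\frac1k\right]$ for every $i\in[n]$ (a class-$k$ knapsack instance). Let $$P(a)=\Big\{x\in[0,1]^n \;:\; \sum_{i=1}^n a_ix_i\le 1\Big\}$$ be the fractional knapsack polytope. For $x\in P(a)$, let $R\subseteq[n]$ be a random set that contains each $i\in[n]$ independently with probability $x_i$, and define the correlation gap $$\mathrm{CG}(a,v,x)=\frac{\mathbb{E}\left[\max\left\{\sum_{i\in S}v_i \;:\; S\subseteq R,\ \chi^S\in P(a)\right\}\right]}{\sum_{i=1}^n v_ix_i},$$ where $\chi^S\in\{0,1\}^n$ is the characteristic vector of $S$, and $\mathrm{CG}(a,v,0)=1$ by convention. Then for every $x\in P(a)$, $$\mathrm{CG}(a,v,x)\ge\frac{1-e^{-2}}{2}.$$ -/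

import Mathlib

noncomputable section

namespace Knapsack

/-- The fractional knapsack polytope `P(a) = {x ∈ [0,1]^n | ∑ a_i x_i ≤ 1}`. -/
def polytope {n : ℕ} (a : Fin n → ℝ) : Set (Fin n → ℝ) :=
  {x | (∀ i, x i ∈ Set.Icc (0 : ℝ) 1) ∧ ∑ i, a i * x i ≤ 1}

/-- An instance of the knapsack problem: sizes `a ∈ [0,1]^n` and values `v ∈ ℝ_{>0}^n`. -/
def IsInstance {n : ℕ} (a v : Fin n → ℝ) : Prop :=
  (∀ i, a i ∈ Set.Icc (0 : ℝ) 1) ∧ ∀ i, 0 < v i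

/-- Item `i` is a class-`k` item. -/
def IsClassItem {n : ℕ} (k : ℕ) (a : Fin n → ℝ) (i : Fin n) : Prop :=
  a i ∈ Set.Ioc (1 / ((k : ℝ) + 1)) (1 / (k : ℝ))

/-- A class-`k` instance: every item is a class-`k` item. -/
def IsClassInstance {n : ℕ} (k : ℕ) (a v : Fin n → ℝ) : Prop :=
  IsInstance a v ∧ ∀ i, IsClassItem k a i

end Knapsack

namespace CorrelationGap

/-- The characteristic vector `χ^S`. -/
def charVec {n : ℕ} (S : Finset (Fin n)) : Fin n → ℝ := fun i => if i ∈ S then 1 else 0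

/-- The probability that the random set which contains each `i` independently with
probability `x i` equals `R`. -/
def sampleProb {n : ℕ} (x : Fin n → ℝ) (R : Finset (Fin n)) : ℝ :=
  (∏ i ∈ R, x i) * ∏ i ∈ Rᶜ, (1 - x i)

/-- The largest value of a feasible set contained in `R`, where `S` is feasible if `χ^S ∈ P`.
The set of values is finite, and it is nonempty if `0 ∈ P`, so the supremum is a maximum. -/
def optValue {n : ℕ} (P : Set (Fin n → ℝ)) (v : Fin n → ℝ) (R : Finset (Fin n)) : ℝ :=
  sSup {w : ℝ | ∃ S : Finset (Fin n), S ⊆ R ∧ charVec S ∈ P ∧ w = ∑ i ∈ S, v i}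

/-- The expectation of `optValue P v R` over the random set `R`. -/
def expectedOpt {n : ℕ} (P : Set (Fin n → ℝ)) (v x : Fin n → ℝ) : ℝ :=
  ∑ R : Finset (Fin n), sampleProb x R * optValue P v R

open Classical in
/-- The correlation gap `CG(P, v, x) = E[max {v(S) | S ⊆ R, χ^S ∈ P}] / ∑ v_i x_i`.
The degenerate ratio with denominator `0` is read as `1`; for positive `v` and nonnegative `x`
this concerns only `x = 0`. -/
def CG {n : ℕ} (P : Set (Fin n → ℝ)) (v x : Fin n → ℝ) : ℝ :=
  if ∑ i, v i * x i = 0 then 1 else expectedOpt P v x / ∑ i, v i * x i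

end CorrelationGap

namespace Knapsack

/-- The shorthand `CG(a, v, x) = CG(P(a), v, x)`. -/
def CG {n : ℕ} (a v x : Fin n → ℝ) : ℝ := CorrelationGap.CG (polytope a) v x

end Knapsack

end

namespace CorrelationGap

variable {n : ℕ}

/-! Since sizes are at most `1/k`, every set of `k` items fits, so the optimum over `R` is at least
the best weight of a subset with at most `k` elements: a weighted rank in a uniform matroid. Since
sizes exceed `1/(k+1)`, the total mass of `x` is at most `k + 1`. Peeling off level sets of the
weights reduces the claim to 0/1 weights (`exists_selection_of_expected_rank`), that is, to bounding
`E[min(|R ∩ T|, k)]` below by a multiple of `s = x(T) ≤ k + 1`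
(`mul_sum_le_sum_sampleProb_min_card`).

For `k = 1` this expectation is the probability of hitting `T`, at least `1 - exp (-s)`, and
concavity on `[0, 2]` gives the constant. For `k ≥ 2` two moments of `|R ∩ T|` already give the
factor `1/2`. -/

lemma sum_sampleProb_mul_prod (x g h : Fin n → ℝ) :
    ∑ R : Finset (Fin n), sampleProb x R * ((∏ i ∈ R, g i) * ∏ i ∈ Rᶜ, h i) =
      ∏ i, (x i * g i + (1 - x i) * h i) := by
  rw [Finset.prod_add, Finset.powerset_univ]
  refine Finset.sum_congr rfl fun R _ => ?_
  rw [sampleProb, ← Finset.compl_eq_univ_sdiff, Finset.prod_mul_distrib, Finset.prod_mul_distrib]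
  ring

lemma sampleProb_nonneg {x : Fin n → ℝ} (hx : ∀ i, x i ∈ Set.Icc (0 : ℝ) 1)
    (R : Finset (Fin n)) : 0 ≤ sampleProb x R :=
  mul_nonneg (Finset.prod_nonneg fun i _ => (hx i).1)
    (Finset.prod_nonneg fun i _ => sub_nonneg.2 (hx i).2)

lemma sum_sampleProb (x : Fin n → ℝ) : ∑ R : Finset (Fin n), sampleProb x R = 1 := by
  simpa using sum_sampleProb_mul_prod x (fun _ => 1) (fun _ => 1)

/-- The probability that the random set contains `U`. -/
lemma sum_sampleProb_subset (x : Fin n → ℝ) (U : Finset (Fin n)) :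
    ∑ R : Finset (Fin n), sampleProb x R * (if U ⊆ R then 1 else 0) = ∏ i ∈ U, x i := by
  -- With these factors the product over `Rᶜ` is the indicator of `U ⊆ R`.
  have h := sum_sampleProb_mul_prod x (fun _ => 1) (fun i => if i ∈ U then 0 else 1)
  have e : ∀ i, x i * 1 + (1 - x i) * (if i ∈ U then 0 else 1) = if i ∈ U then x i else 1 := by
    intro i; split_ifs <;> ring
  rw [Finset.prod_congr rfl fun i _ => e i, Finset.prod_ite_mem, Finset.univ_inter] at h
  rw [← h]
  refine Finset.sum_congr rfl fun R _ => ?_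
  congr 1
  split_ifs with hU
  · rw [Finset.prod_const_one, one_mul, Finset.prod_eq_one]
    intro i hi
    rw [if_neg fun hiU => Finset.mem_compl.1 hi (hU hiU)]
  · obtain ⟨i, hiU, hiR⟩ := Finset.not_subset.1 hU
    symm
    exact mul_eq_zero_of_right _ (Finset.prod_eq_zero (Finset.mem_compl.2 hiR) (by simp [hiU]))

/-- The probability that the random set avoids `U`. -/
lemma sum_sampleProb_disjoint (x : Fin n → ℝ) (U : Finset (Fin n)) :
    ∑ R : Finset (Fin n), sampleProb x R * (if Disjoint R U then 1 else 0) =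
      ∏ i ∈ U, (1 - x i) := by
  have h := sum_sampleProb_mul_prod x (fun i => if i ∈ U then 0 else 1) (fun _ => 1)
  have e : ∀ i, x i * (if i ∈ U then 0 else 1) + (1 - x i) * 1 =
      if i ∈ U then 1 - x i else 1 := by
    intro i; split_ifs <;> ring
  rw [Finset.prod_congr rfl fun i _ => e i, Finset.prod_ite_mem, Finset.univ_inter] at h
  rw [← h]
  refine Finset.sum_congr rfl fun R _ => ?_
  congr 1
  split_ifs with hU
  · rw [Finset.prod_const_one, mul_one, Finset.prod_eq_one]
    intro i hi
    rw [if_neg (Finset.disjoint_left.1 hU hi)]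
  · obtain ⟨i, hiR, hiU⟩ := Finset.not_disjoint_iff.1 hU
    symm
    exact mul_eq_zero_of_left (Finset.prod_eq_zero hiR (by simp [hiU])) _

lemma card_inter_eq_sum (R T : Finset (Fin n)) :
    (((R ∩ T).card : ℕ) : ℝ) = ∑ i ∈ T, if {i} ⊆ R then (1 : ℝ) else 0 := by
  simp [Finset.inter_comm R T, ← Finset.filter_mem_eq_inter]

/-- The first moment of `|R ∩ T|`. -/
lemma sum_sampleProb_card_inter (x : Fin n → ℝ) (T : Finset (Fin n)) :
    ∑ R : Finset (Fin n), sampleProb x R * ((R ∩ T).card : ℝ) = ∑ i ∈ T, x i := by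
  simp only [card_inter_eq_sum, Finset.mul_sum]
  rw [Finset.sum_comm]
  simp only [sum_sampleProb_subset, Finset.prod_singleton]

/-- The second moment of `|R ∩ T|`. -/
lemma sum_sampleProb_card_inter_sq_le (x : Fin n → ℝ) (T : Finset (Fin n)) :
    ∑ R : Finset (Fin n), sampleProb x R * ((R ∩ T).card : ℝ) ^ 2 ≤
      ∑ i ∈ T, x i + (∑ i ∈ T, x i) ^ 2 := by
  have e : ∀ R : Finset (Fin n), ((R ∩ T).card : ℝ) ^ 2 =
      ∑ i ∈ T, ∑ j ∈ T, if {i, j} ⊆ R then (1 : ℝ) else 0 := by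
    intro R
    rw [card_inter_eq_sum, sq, Finset.sum_mul_sum]
    refine Finset.sum_congr rfl fun i _ => Finset.sum_congr rfl fun j _ => ?_
    simp only [Finset.singleton_subset_iff, Finset.insert_subset_iff, ite_and]
    split_ifs <;> simp
  have hs : ∑ R : Finset (Fin n), sampleProb x R * ((R ∩ T).card : ℝ) ^ 2 =
      ∑ i ∈ T, ∑ j ∈ T, ∏ l ∈ ({i, j} : Finset (Fin n)), x l := by
    simp only [e, Finset.mul_sum]
    rw [Finset.sum_comm]
    refine Finset.sum_congr rfl fun i _ => ?_
    rw [Finset.sum_comm]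
    simp only [sum_sampleProb_subset]
  have hT : ∑ i ∈ T, x i + (∑ i ∈ T, x i) ^ 2 =
      ∑ i ∈ T, ∑ j ∈ T, ((if i = j then x i else 0) + x i * x j) := by
    rw [sq, Finset.sum_mul_sum, ← Finset.sum_add_distrib]
    refine Finset.sum_congr rfl fun i hi => ?_
    rw [Finset.sum_add_distrib, Finset.sum_ite_eq, if_pos hi]
  rw [hs, hT]
  -- Independence gives equality off the diagonal; on it the slack is `x i * x i`.
  refine Finset.sum_le_sum fun i _ => Finset.sum_le_sum fun j _ => ?_
  by_cases hij : i = j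
  · subst hij
    simpa using mul_self_nonneg (x i)
  · rw [Finset.prod_pair hij, if_neg hij, zero_add]

/-- For `s ∈ [0, 2]` the concave function `1 - exp (-s)` lies above its chord. -/
lemma mul_le_one_sub_exp_neg {s : ℝ} (h0 : 0 ≤ s) (h2 : s ≤ 2) :
    (1 - Real.exp (-2)) / 2 * s ≤ 1 - Real.exp (-s) := by
  have h := convexOn_exp.2 (Set.mem_univ (0 : ℝ)) (Set.mem_univ (-2 : ℝ))
    (show 0 ≤ 1 - s / 2 by linarith) (show 0 ≤ s / 2 by linarith) (by ring)
  have e : (1 - s / 2) • (0 : ℝ) + (s / 2) • (-2 : ℝ) = -s := by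
    simp only [smul_eq_mul]; ring
  rw [e, Real.exp_zero, smul_eq_mul, smul_eq_mul] at h
  linarith

/-- The expected rank of `R ∩ T` in the uniform matroid of rank `k`. -/
lemma mul_sum_le_sum_sampleProb_min_card {k : ℕ} (hk : 1 ≤ k) {x : Fin n → ℝ}
    (hx : ∀ i, x i ∈ Set.Icc (0 : ℝ) 1) (T : Finset (Fin n)) (hT : ∑ i ∈ T, x i ≤ k + 1) :
    (1 - Real.exp (-2)) / 2 * ∑ i ∈ T, x i ≤
      ∑ R : Finset (Fin n), sampleProb x R * (min (R ∩ T).card k : ℕ) := by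
  have hs0 : 0 ≤ ∑ i ∈ T, x i := Finset.sum_nonneg fun i _ => (hx i).1
  obtain rfl | hk2 := hk.eq_or_lt
  · have e : ∀ R : Finset (Fin n), ((min (R ∩ T).card 1 : ℕ) : ℝ) =
        1 - if Disjoint R T then 1 else 0 := by
      intro R
      split_ifs with h
      · simp [Finset.disjoint_iff_inter_eq_empty.1 h]
      · have hc : 1 ≤ (R ∩ T).card := by
          rw [Finset.disjoint_iff_inter_eq_empty] at h
          exact Finset.card_pos.2 (Finset.nonempty_iff_ne_empty.2 h)
        simp [min_eq_right hc]
    simp only [e, mul_sub, mul_one, Finset.sum_sub_distrib, sum_sampleProb,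
      sum_sampleProb_disjoint]
    have hp : ∏ i ∈ T, (1 - x i) ≤ Real.exp (-∑ i ∈ T, x i) := by
      rw [← Finset.sum_neg_distrib, Real.exp_sum]
      exact Finset.prod_le_prod (fun i _ => sub_nonneg.2 (hx i).2)
        fun i _ => Real.one_sub_le_exp_neg (x i)
    have := mul_le_one_sub_exp_neg hs0 (by norm_num at hT; linarith)
    linarith
  · have hk2' : (2 : ℝ) ≤ k := by exact_mod_cast hk2
    have hk0 : (0 : ℝ) < 4 * k := by linarith
    -- This parabola has slope `1` at `0` and peaks at height `k` when `m = 2k`; its gap to `k` is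
    -- `(m - 2k)^2 / (4k)`.
    have hq : ∀ m : ℕ, (m : ℝ) - (m : ℝ) ^ 2 / (4 * k) ≤ (min m k : ℕ) := by
      intro m
      rw [Nat.cast_min]
      refine le_min (sub_le_self _ (by positivity)) ?_
      rw [sub_le_iff_le_add, ← sub_le_iff_le_add', le_div_iff₀ hk0]
      nlinarith [sq_nonneg ((m : ℝ) - 2 * k)]
    have h1 : ∑ i ∈ T, x i - (∑ i ∈ T, x i + (∑ i ∈ T, x i) ^ 2) / (4 * k) ≤
        ∑ R : Finset (Fin n), sampleProb x R * (min (R ∩ T).card k : ℕ) := by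
      calc _ ≤ ∑ R : Finset (Fin n), sampleProb x R * ((R ∩ T).card : ℝ) -
            (∑ R : Finset (Fin n), sampleProb x R * ((R ∩ T).card : ℝ) ^ 2) / (4 * k) := by
            rw [sum_sampleProb_card_inter]
            gcongr
            exact sum_sampleProb_card_inter_sq_le x T
        _ = ∑ R : Finset (Fin n), sampleProb x R *
            (((R ∩ T).card : ℝ) - ((R ∩ T).card : ℝ) ^ 2 / (4 * k)) := by
            rw [Finset.sum_div, ← Finset.sum_sub_distrib]
            exact Finset.sum_congr rfl fun R _ => by ring
        _ ≤ _ := Finset.sum_le_sum fun R _ =>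
            mul_le_mul_of_nonneg_left (hq _) (sampleProb_nonneg hx R)
    refine le_trans ?_ h1
    -- Here `k ≥ 2` matters: `1 + s ≤ k + 2 ≤ 2k`.
    have h2 : (∑ i ∈ T, x i + (∑ i ∈ T, x i) ^ 2) / (4 * k) ≤ (∑ i ∈ T, x i) / 2 := by
      rw [div_le_iff₀ hk0]
      nlinarith
    nlinarith [Real.exp_pos (-2)]

/-- A lower bound on expected ranks in the uniform matroid of rank `k` extends to all nonnegative
weights, by decomposing the weights into level sets. -/
lemma exists_selection_of_expected_rank {k : ℕ} {x : Fin n → ℝ} {c : ℝ}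
    (hx : ∀ i, x i ∈ Set.Icc (0 : ℝ) 1)
    (hc : ∀ T : Finset (Fin n), c * ∑ i ∈ T, x i ≤
      ∑ R : Finset (Fin n), sampleProb x R * (min (R ∩ T).card k : ℕ))
    (v : Fin n → ℝ) (hv : ∀ i, 0 ≤ v i) :
    ∃ S : Finset (Fin n) → Finset (Fin n), (∀ R, S R ⊆ R ∧ (S R).card ≤ k) ∧
      c * ∑ i, v i * x i ≤ ∑ R : Finset (Fin n), sampleProb x R * ∑ i ∈ S R, v i := by
  induction hN : (Finset.univ.filter fun i => 0 < v i).card using Nat.strong_induction_on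
    generalizing v with
  | _ N ih =>
    set T := Finset.univ.filter fun i => 0 < v i with hTdef
    have hvT : ∀ i, i ∉ T → v i = 0 := fun i hi =>
      le_antisymm (not_lt.1 fun h => hi (by simp [hTdef, h])) (hv i)
    obtain hT | hT := T.eq_empty_or_nonempty
    · refine ⟨fun _ => ∅, fun R => ⟨Finset.empty_subset R, by simp⟩, ?_⟩
      have : ∀ i, v i = 0 := fun i => hvT i (by simp [hT])
      simp [this]
    obtain ⟨j, hjT, hj⟩ := T.exists_min_image v hT
    have hj0 : 0 < v j := (Finset.mem_filter.1 hjT).2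
    -- Lowering the positive weights by their minimum removes `j` from the support, so the induction
    -- on support size applies.
    set w : Fin n → ℝ := fun i => if i ∈ T then v i - v j else 0 with hw
    have hw0 : ∀ i, 0 ≤ w i := by
      intro i
      simp only [hw]
      split_ifs with h
      · exact sub_nonneg.2 (hj i h)
      · exact le_rfl
    have hcard : (Finset.univ.filter fun i => 0 < w i).card < N := by
      rw [← hN]
      refine Finset.card_lt_card ((Finset.ssubset_iff_of_subset fun i hi => ?_).2 ⟨j, hjT, ?_⟩)
      · by_contra h
        simp [hw, h] at hi
      · simp [hw]
    obtain ⟨S, hS, hSv⟩ := ih _ hcard w hw0 rfl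
    -- Matroid augmentation: discarding elements outside `T` loses no `w`-weight, and enlarging
    -- within `R ∩ T` to full rank collects `v j` once per element.
    have hex : ∀ R : Finset (Fin n), ∃ U, S R ∩ T ⊆ U ∧ U ⊆ R ∩ T ∧
        U.card = min (R ∩ T).card k := fun R =>
      Finset.exists_subsuperset_card_eq (Finset.inter_subset_inter_right (hS R).1)
        (le_min (Finset.card_le_card (Finset.inter_subset_inter_right (hS R).1))
          ((Finset.card_le_card Finset.inter_subset_left).trans (hS R).2))
        (min_le_left _ _)
    choose U hSU hUR hU using hex
    refine ⟨U, fun R => ⟨(hUR R).trans Finset.inter_subset_left, (hU R).trans_le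
      (min_le_right _ _)⟩, ?_⟩
    have hvw : ∑ i, v i * x i = ∑ i, w i * x i + v j * ∑ i ∈ T, x i := by
      rw [Finset.mul_sum, ← Finset.sum_filter_add_sum_filter_not Finset.univ (· ∈ T)
        (fun i => v i * x i), ← Finset.sum_filter_add_sum_filter_not Finset.univ (· ∈ T)
        (fun i => w i * x i)]
      have h1 : ∑ i with i ∉ T, v i * x i = 0 := Finset.sum_eq_zero fun i hi => by
        rw [hvT i (Finset.mem_filter.1 hi).2, zero_mul]
      have h2 : ∑ i with i ∉ T, w i * x i = 0 := Finset.sum_eq_zero fun i hi => by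
        simp [hw, (Finset.mem_filter.1 hi).2]
      rw [h1, h2, Finset.filter_mem_eq_inter, Finset.univ_inter, add_zero, add_zero,
        ← Finset.sum_add_distrib]
      refine Finset.sum_congr rfl fun i hi => ?_
      simp only [hw, if_pos hi]
      ring
    have hR : ∀ R, ∑ i ∈ S R, w i + v j * (min (R ∩ T).card k : ℕ) ≤ ∑ i ∈ U R, v i := by
      intro R
      have h1 : ∑ i ∈ S R, w i = ∑ i ∈ S R ∩ T, w i := by
        refine (Finset.sum_subset Finset.inter_subset_left fun i hi hi' => ?_).symm
        have : i ∉ T := fun h => hi' (Finset.mem_inter.2 ⟨hi, h⟩)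
        simp [hw, this]
      have h2 : ∑ i ∈ S R ∩ T, w i ≤ ∑ i ∈ U R, w i :=
        Finset.sum_le_sum_of_subset_of_nonneg (hSU R) fun i _ _ => hw0 i
      have h3 : ∑ i ∈ U R, v i = ∑ i ∈ U R, w i + v j * ((U R).card : ℝ) := by
        rw [mul_comm, ← nsmul_eq_mul, ← Finset.sum_const, ← Finset.sum_add_distrib]
        refine Finset.sum_congr rfl fun i hi => ?_
        have : i ∈ T := (Finset.mem_inter.1 (hUR R hi)).2
        simp [hw, this]
      rw [h3, hU R, h1]
      linarith
    calc c * ∑ i, v i * x i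
        = c * ∑ i, w i * x i + v j * (c * ∑ i ∈ T, x i) := by rw [hvw]; ring
      _ ≤ ∑ R : Finset (Fin n), sampleProb x R * ∑ i ∈ S R, w i +
          v j * ∑ R : Finset (Fin n), sampleProb x R * (min (R ∩ T).card k : ℕ) :=
          add_le_add hSv (mul_le_mul_of_nonneg_left (hc T) hj0.le)
      _ = ∑ R : Finset (Fin n), sampleProb x R *
          (∑ i ∈ S R, w i + v j * (min (R ∩ T).card k : ℕ)) := by
          rw [Finset.mul_sum, ← Finset.sum_add_distrib]
          exact Finset.sum_congr rfl fun R _ => by ring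
      _ ≤ _ := Finset.sum_le_sum fun R _ =>
          mul_le_mul_of_nonneg_left (hR R) (sampleProb_nonneg hx R)

lemma sum_le_optValue {P : Set (Fin n → ℝ)} (v : Fin n → ℝ) {R S : Finset (Fin n)}
    (hSR : S ⊆ R) (hS : charVec S ∈ P) : ∑ i ∈ S, v i ≤ optValue P v R := by
  -- Boundedness is needed because `sSup` of an unbounded real set defaults to `0`.
  refine le_csSup (Set.Finite.bddAbove ?_) ⟨S, hSR, hS, rfl⟩
  refine (Set.finite_range fun S : Finset (Fin n) => ∑ i ∈ S, v i).subset ?_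
  rintro w ⟨S', -, -, rfl⟩
  exact ⟨S', rfl⟩

end CorrelationGap

namespace Knapsack

variable {n k : ℕ} {a : Fin n → ℝ}

/-- Any `k` class-`k` items fit into the knapsack. -/
lemma charVec_mem_polytope (hk : 1 ≤ k) (ha : ∀ i, IsClassItem k a i) {S : Finset (Fin n)}
    (hS : S.card ≤ k) : CorrelationGap.charVec S ∈ polytope a := by
  have hk0 : (0 : ℝ) < k := by exact_mod_cast hk
  refine ⟨fun i => ?_, ?_⟩
  · unfold CorrelationGap.charVec
    split_ifs <;> simp
  · have e : ∑ i, a i * CorrelationGap.charVec S i = ∑ i ∈ S, a i := by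
      simp [CorrelationGap.charVec]
    rw [e]
    calc ∑ i ∈ S, a i ≤ S.card • (1 / (k : ℝ)) := Finset.sum_le_card_nsmul _ _ _
          fun i _ => (ha i).2
      _ ≤ 1 := by
          rw [nsmul_eq_mul, mul_one_div, div_le_one hk0]
          exact_mod_cast hS

/-- As `(k + 1) * a i > 1`, each `x i` is at most `k + 1` times the capacity it uses. -/
lemma sum_le_of_mem_polytope (ha : ∀ i, IsClassItem k a i) {x : Fin n → ℝ}
    (hx : x ∈ polytope a) (T : Finset (Fin n)) : ∑ i ∈ T, x i ≤ k + 1 := by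
  have hk0 : (0 : ℝ) < k + 1 := by positivity
  calc ∑ i ∈ T, x i ≤ ∑ i, x i := Finset.sum_le_sum_of_subset_of_nonneg
        (Finset.subset_univ T) fun i _ _ => (hx.1 i).1
    _ ≤ ∑ i, (k + 1) * (a i * x i) := by
        refine Finset.sum_le_sum fun i _ => ?_
        rw [← mul_assoc]
        refine le_mul_of_one_le_left (hx.1 i).1 ?_
        have := (div_lt_iff₀ hk0).1 (ha i).1
        linarith
    _ ≤ k + 1 := by
        rw [← Finset.mul_sum]
        exact mul_le_of_le_one_right hk0.le hx.2

end Knapsack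

theorem mainTheorem1 {n k : ℕ} (hk : 1 ≤ k) (a v : Fin n → ℝ)
    (hI : Knapsack.IsClassInstance k a v) (x : Fin n → ℝ) (hx : x ∈ Knapsack.polytope a) :
    (1 - Real.exp (-2)) / 2 ≤ Knapsack.CG a v x := by
  obtain ⟨⟨-, hv⟩, ha⟩ := hI
  unfold Knapsack.CG CorrelationGap.CG
  split_ifs with h0
  · linarith [Real.exp_pos (-2)]
  · have hpos : 0 < ∑ i, v i * x i := lt_of_le_of_ne
      (Finset.sum_nonneg fun i _ => mul_nonneg (hv i).le (hx.1 i).1) (Ne.symm h0)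
    rw [le_div_iff₀ hpos]
    obtain ⟨S, hS, hSv⟩ := CorrelationGap.exists_selection_of_expected_rank hx.1
      (fun T => CorrelationGap.mul_sum_le_sum_sampleProb_min_card hk hx.1 T
        (Knapsack.sum_le_of_mem_polytope ha hx T)) v (fun i => (hv i).le)
    exact hSv.trans (Finset.sum_le_sum fun R _ => mul_le_mul_of_nonneg_left
      (CorrelationGap.sum_le_optValue v (hS R).1
        (Knapsack.charVec_mem_polytope hk ha (hS R).2))
      (CorrelationGap.sampleProb_nonneg hx.1 R))
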